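/- Let $n\ge 2$ be an integer and, for a $C^2$ function $V$ on $(0,\infty)$, put \[ \mathcal F[V]=VV''-\tfrac12(V')^2+\frac{n-1-V}{\sigma}V'+\frac{2(n-1)}{\sigma^2}(V-V^2), \qquad d\mathcal F_V[W]=\frac{d}{d\epsilon}\Big|_{\epsilon=0}\mathcal F[V+\epsilon W]. \] Let $\mathfrak B:(0,\infty)\to(0,1)$ be the normalized profile of the Bryant steady soliton metric $\frac{(d\sigma)^2}{\mathfrak B(\sigma)}+\sigma^2g_{\mathrm{can}}$ on $\mathbb R^{n+1}$, i.e. the solution of $\mathcal F[\mathfrak B]=0$ with $0<\mathfrak B<1$, $\mathfrak B(\sigma)\to1$ as $\sigma\searrow0$ and $\mathfrak B(\sigma)=\sigma^{-2}+o(\sigma^{-2})$ as $\sigma\to\infty$. Then the linear equation \[ d\mathcal F_{\mathfrak B}[\mathfrak C]=-\sigma\,\mathfrak B'(\sigma)\qquad(\sigma>0)\tag{1} \] has a $C^2$ solution $\mathfrak C:(0,\infty)\to(0,\infty)$ such that, for some constant $M>0$, \[ \mathfrak C(\sigma)=M\sigma^2+o(\sigma^2)\quad(\sigma\searrow0),\qquad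 \mathfrak C(\sigma)=\frac1{n-1}+o(1)\quad(\sigma\to\infty). \] Moreover: 1. The $C^2$ solutions of (1) on $(0,\infty)$ that are bounded near $\sigma=0$ are exactly the functions $\tilde{\mathfrak C}(\sigma)=\mathfrak C(\sigma)-\lambda\,\sigma\,\mathfrak B'(\sigma)$, $\lambda\in\mathbb R$. 2. For every $k>0$, with $V_0(\sigma)=\mathfrak B(k\sigma)$, the function $V_1(\sigma)=\mathfrak C(k\sigma)/k^2$ is a solution of $d\mathcal F_{V_0}[V_1]=-\sigma V_0'(\sigma)$ on $(0,\infty)$. -/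

import Mathlib

open Set Filter Topology Asymptotics

noncomputable section

namespace BryantNextTerm

/-- The quasilinear second order operator
`𝓕[V] = V V'' - (V')² / 2 + ((n - 1 - V) / σ) V' + (2 (n - 1) / σ²) (V - V²)`. -/
def opF (n : ℕ) (V : ℝ → ℝ) (σ : ℝ) : ℝ :=
  V σ * deriv (deriv V) σ - (1 / 2) * (deriv V σ) ^ 2
    + (((n : ℝ) - 1 - V σ) / σ) * deriv V σ
    + (2 * ((n : ℝ) - 1) / σ ^ 2) * (V σ - V σ ^ 2)

/-- The first variation `d𝓕_V[W] = d/dε 𝓕[V + ε W]` at `ε = 0`, as a function of `σ`. -/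
def firstVariation (n : ℕ) (V W : ℝ → ℝ) (σ : ℝ) : ℝ :=
  deriv (fun ε : ℝ => opF n (fun s => V s + ε * W s) σ) 0

/-- `B` (restricted to `(0, ∞)`) is the profile function of the Bryant steady soliton metric
`(dσ)² / B(σ) + σ² g_can` on `ℝⁿ⁺¹`, scaled so that `B(σ) = σ⁻² + o(σ⁻²)` at infinity:
a solution of `𝓕[B] = 0` with values in `(0, 1)` which closes up at the origin (`B(0⁺) = 1`). -/
structure IsBryantSoliton (n : ℕ) (B : ℝ → ℝ) : Prop where
  contDiffOn : ContDiffOn ℝ 2 B (Ioi 0)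
  stationary : ∀ σ : ℝ, 0 < σ → opF n B σ = 0
  pos : ∀ σ : ℝ, 0 < σ → 0 < B σ
  lt_one : ∀ σ : ℝ, 0 < σ → B σ < 1
  tendsto_zero : Tendsto B (𝓝[>] 0) (𝓝 1)
  normalized : (fun σ : ℝ => B σ - 1 / σ ^ 2) =o[atTop] (fun σ : ℝ => 1 / σ ^ 2)

/-- `W` is a classical solution on `(0, ∞)` of the linear equation `d𝓕_V[W] = -σ V'(σ)`. -/
structure IsSolution (n : ℕ) (V W : ℝ → ℝ) : Prop where
  contDiffOn : ContDiffOn ℝ 2 W (Ioi 0)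
  equation : ∀ σ : ℝ, 0 < σ → firstVariation n V W σ = -σ * deriv V σ

/-- `W` is bounded at `σ = 0`, i.e. on some interval `(0, δ)`. -/
def BoundedAtZero (W : ℝ → ℝ) : Prop :=
  ∃ K δ : ℝ, 0 < δ ∧ ∀ σ : ℝ, 0 < σ → σ < δ → |W σ| ≤ K

/-- The first variation as an explicit linear differential operator. -/
theorem firstVariation_eq (n : ℕ) {V W : ℝ → ℝ} (hV : ContDiffOn ℝ 2 V (Ioi 0))
    (hW : ContDiffOn ℝ 2 W (Ioi 0)) {σ : ℝ} (hσ : 0 < σ) :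
    firstVariation n V W σ =
      V σ * deriv (deriv W) σ
        + (((n : ℝ) - 1 - V σ) / σ - deriv V σ) * deriv W σ
        + (deriv (deriv V) σ - deriv V σ / σ
            + (2 * ((n : ℝ) - 1) / σ ^ 2) * (1 - 2 * V σ)) * W σ := by
  have key : ∀ {f : ℝ → ℝ}, ContDiffOn ℝ 2 f (Ioi 0) → ∀ s : ℝ, 0 < s →
      DifferentiableAt ℝ f s ∧ DifferentiableAt ℝ (deriv f) s := by
    intro f hf s hs
    have h2 : ContDiffOn ℝ (1 + 1) f (Ioi 0) := by
      have h : (1 + 1 : WithTop ℕ∞) = 2 := by norm_num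
      rw [h]; exact hf
    have h3 := (contDiffOn_succ_iff_deriv_of_isOpen isOpen_Ioi).1 h2
    exact ⟨h3.1.differentiableAt (isOpen_Ioi.mem_nhds hs),
      (h3.2.2.differentiableOn (by norm_num)).differentiableAt (isOpen_Ioi.mem_nhds hs)⟩
  have d1 : ∀ ε s : ℝ, 0 < s →
      deriv (fun s => V s + ε * W s) s = deriv V s + ε * deriv W s := by
    intro ε s hs
    exact ((key hV s hs).1.hasDerivAt.add ((key hW s hs).1.hasDerivAt.const_mul ε)).deriv
  have d2 : ∀ ε : ℝ, deriv (deriv (fun s => V s + ε * W s)) σ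
      = deriv (deriv V) σ + ε * deriv (deriv W) σ := by
    intro ε
    have he : deriv (fun s => V s + ε * W s) =ᶠ[𝓝 σ] fun s => deriv V s + ε * deriv W s := by
      filter_upwards [isOpen_Ioi.mem_nhds hσ] with s hs using d1 ε s hs
    rw [he.deriv_eq]
    exact ((key hV σ hσ).2.hasDerivAt.add ((key hW σ hσ).2.hasDerivAt.const_mul ε)).deriv
  unfold firstVariation
  simp only [opF, d1 _ σ hσ, d2]
  have lin : ∀ a b : ℝ, HasDerivAt (fun ε : ℝ => a + ε * b) b 0 := by
    intro a b
    simpa using ((hasDerivAt_id (0 : ℝ)).mul_const b).const_add a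
  have h0 := lin (V σ) (W σ)
  have h1 := lin (deriv V σ) (deriv W σ)
  have h2 := lin (deriv (deriv V) σ) (deriv (deriv W) σ)
  have hh := (((h0.mul h2).sub ((h1.pow 2).const_mul (1 / 2))).add
    (((h0.const_sub ((n : ℝ) - 1)).div_const σ).mul h1)).add
    ((h0.sub (h0.pow 2)).const_mul (2 * ((n : ℝ) - 1) / σ ^ 2))
  refine (hh.congr_deriv ?_).deriv
  simp
  ring

end BryantNextTerm

end

namespace BryantNextTerm

/-! Write `y = σB'`. Dilations preserve `𝓕[V] = 0`, so `y` solves the homogeneous linearized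
equation; moreover `y < 0`. Reduction of order `C = -y u` leaves a first order linear equation for
`ψ = u'` with integrating factor `y²ρ` (`exists_weight`, `exists_factor`). Choosing `u(0⁺) = 1` and
`ψ ≥ 0` makes `C` positive. At the origin, a conserved quantity of the soliton gives `1 - B ~ κσ²`
and `-y ~ 2κσ²` (`exists_tendsto_nhdsGT_zero`), hence `M = 2κ`. At infinity, `y`, `y/B`, `ψ/σ` and
`u/σ²` each satisfy a relaxation equation and follow its equilibrium (`tendsto_of_relaxation`),
which yields `C → 1/(n-1)`. For uniqueness, the weighted Wronskian of `y` and a homogeneous solution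
`w` is constant. If it is nonzero, `w/y` blows up like `σ^{-(n+1)}`, whereas boundedness of `w`
allows only `σ⁻²` (`exists_eq_mul_scaleDeriv`). -/

/-! ### Calculus on the half-line: comparison, relaxation, primitives -/

theorem monotoneOn_Ioi_of_hasDerivAt {f f' : ℝ → ℝ} {a : ℝ}
    (hf : ∀ s, a < s → HasDerivAt f (f' s) s) (h : ∀ s, a < s → 0 ≤ f' s) :
    MonotoneOn f (Ioi a) := by
  refine monotoneOn_of_hasDerivWithinAt_nonneg (f' := f') (convex_Ioi a)
    (fun s hs => (hf s hs).continuousAt.continuousWithinAt) ?_ ?_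
  · intro s hs
    rw [interior_Ioi] at hs
    exact (hf s hs).hasDerivWithinAt
  · intro s hs
    rw [interior_Ioi] at hs
    exact h s hs

theorem constant_of_hasDerivAt_zero {f : ℝ → ℝ}
    (hf : ∀ s, 0 < s → HasDerivAt f 0 s) {s t : ℝ} (hs : 0 < s) (ht : 0 < t) : f s = f t :=
  isOpen_Ioi.is_const_of_deriv_eq_zero isPreconnected_Ioi
    (fun x hx => (hf x hx).differentiableAt.differentiableWithinAt)
    (fun x hx => (hf x hx).deriv) (mem_Ioi.2 hs) (mem_Ioi.2 ht)

/-- A function that decreases at least logarithmically fast whenever it is above the level `m`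
eventually stays below `m`. -/
theorem eventually_le_of_deriv_le {f f' : ℝ → ℝ} {m c : ℝ} (hc : 0 < c)
    (hf : ∀ s, 0 < s → HasDerivAt f (f' s) s)
    (h : ∀ᶠ s in atTop, m ≤ f s → s * f' s ≤ -c) : ∀ᶠ s in atTop, f s ≤ m := by
  obtain ⟨a, ha⟩ := eventually_atTop.1 (h.and (eventually_gt_atTop 0))
  have ha0 : 0 < a := (ha a le_rfl).2
  obtain ⟨b, hab, hb⟩ : ∃ b, a < b ∧ f b ≤ m := by
    -- If `f` stayed above `m`, then `f + c log s` would be nonincreasing and `f` would tend to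
    -- `-∞`.
    by_contra! hcon
    have hmono : MonotoneOn (fun s => -(f s + c * Real.log s)) (Ioi a) := by
      refine monotoneOn_Ioi_of_hasDerivAt (f' := fun s => -(f' s + c * s⁻¹)) ?_ ?_
      · intro s hs
        have hs0 := ha0.trans hs
        exact ((hf s hs0).add ((Real.hasDerivAt_log hs0.ne').const_mul c)).neg
      · intro s hs
        have hs0 := ha0.trans hs
        have h1 := (ha s hs.le).1 (hcon s hs).le
        have h2 : s * (f' s + c * s⁻¹) ≤ 0 := by
          have : s * (f' s + c * s⁻¹) = s * f' s + c := by field_simp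
          linarith
        have h3 := nonpos_of_mul_nonpos_right h2 hs0
        linarith
    have hlog : Tendsto (fun s => c * Real.log s) atTop atTop :=
      Real.tendsto_log_atTop.const_mul_atTop hc
    obtain ⟨s, hs, hsa⟩ := ((hlog.eventually_gt_atTop
      (f (a + 1) + c * Real.log (a + 1) - m)).and (eventually_gt_atTop (a + 1))).exists
    have h1 := hmono (mem_Ioi.2 (lt_add_one a)) (mem_Ioi.2 (by linarith : a < s)) hsa.le
    have h2 := hcon s (by linarith)
    simp only at h1
    linarith
  filter_upwards [eventually_ge_atTop b] with s hs
  have hpos : ∀ t, b ≤ t → 0 < t := fun t ht => ha0.trans (hab.trans_le ht)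
  -- The level `m` is a barrier: `f' < 0` wherever `f = m`.
  refine image_le_of_deriv_right_lt_deriv_boundary' (f := f) (f' := f') (a := b) (b := s)
    (B := fun _ => m) (B' := fun _ => 0)
    (fun t ht => (hf t (hpos t ht.1)).continuousAt.continuousWithinAt)
    (fun t ht => (hf t (hpos t ht.1)).hasDerivWithinAt) hb continuousOn_const
    (fun t _ => hasDerivWithinAt_const _ _ _) ?_ ⟨hs, le_rfl⟩
  intro t ht htm
  have h1 := (ha t (hab.le.trans ht.1)).1 htm.ge
  by_contra! h2
  have := mul_nonneg (hpos t ht.1).le h2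
  linarith

/-- Solutions of the relaxation equation `s f' = θ (b - Ω f)` approach the limit of `b / Ω`. -/
theorem tendsto_of_relaxation {f f' θ b Ω : ℝ → ℝ} {l ω : ℝ} (hω : 0 < ω)
    (hf : ∀ s, 0 < s → HasDerivAt f (f' s) s)
    (heq : ∀ s, 0 < s → s * f' s = θ s * (b s - Ω s * f s))
    (hθ : ∀ s, 0 < s → 1 ≤ θ s) (hΩ : ∀ᶠ s in atTop, ω ≤ Ω s)
    (hb : Tendsto (fun s => b s - Ω s * l) atTop (𝓝 0)) : Tendsto f atTop (𝓝 l) := by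
  have key : ∀ ε : ℝ, 0 < ε →
      (∀ᶠ s in atTop, f s ≤ l + ε) ∧ (∀ᶠ s in atTop, -f s ≤ -l + ε) := by
    intro ε hε
    have hωε := mul_pos hω hε
    have hsmall : ∀ᶠ s in atTop, |b s - Ω s * l| < ω * ε / 2 := by
      have := (Metric.tendsto_nhds.1 hb) (ω * ε / 2) (by positivity)
      simpa [Real.dist_eq] using this
    constructor
    -- Where `f ≥ l + ε`, `b - Ωf = (b - Ωl) - Ω(f - l) ≤ ωε/2 - ωε`, and `θ ≥ 1` only strengthens
    -- the decay.
    · refine eventually_le_of_deriv_le (c := ω * ε / 2) (by positivity) hf ?_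
      filter_upwards [hsmall, hΩ, eventually_gt_atTop 0] with s h1 h2 hs h3
      rw [heq s hs]
      have h4 := (abs_lt.1 h1).2
      have h5 : ω * ε ≤ Ω s * (f s - l) := mul_le_mul h2 (by linarith) hε.le (by linarith)
      have h6 : b s - Ω s * f s ≤ -(ω * ε / 2) := by linarith
      nlinarith [hθ s hs]
    · refine eventually_le_of_deriv_le (c := ω * ε / 2) (by positivity)
        (fun s hs => (hf s hs).neg) ?_
      filter_upwards [hsmall, hΩ, eventually_gt_atTop 0] with s h1 h2 hs h3
      have h4 := (abs_lt.1 h1).1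
      have h5 : ω * ε ≤ Ω s * (l - f s) := mul_le_mul h2 (by linarith) hε.le (by linarith)
      have h6 : ω * ε / 2 ≤ b s - Ω s * f s := by linarith
      have h7 := heq s hs
      nlinarith [hθ s hs]
  rw [Metric.tendsto_nhds]
  intro ε hε
  filter_upwards [(key (ε / 2) (by positivity)).1, (key (ε / 2) (by positivity)).2] with s h1 h2
  rw [Real.dist_eq, abs_lt]
  constructor <;> linarith

/-- Extended by zero to the left, `f` is continuous on the whole line, so it can be integrated from
`0`. -/
theorem exists_primitive {f : ℝ → ℝ} (hf : ContinuousOn f (Ioi 0))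
    (h0 : Tendsto f (𝓝[>] 0) (𝓝 0)) :
    ∃ F : ℝ → ℝ, (∀ s, 0 < s → HasDerivAt F (f s) s) ∧ Tendsto F (𝓝[>] 0) (𝓝 0) := by
  set g : ℝ → ℝ := fun s => if 0 < s then f s else 0 with hg
  have hgpos : ∀ s, 0 < s → g s = f s := fun s hs => if_pos hs
  have hcont : Continuous g := by
    rw [continuous_iff_continuousAt]
    intro s
    rcases lt_trichotomy s 0 with hs | rfl | hs
    · have : g =ᶠ[𝓝 s] fun _ => 0 := by
        filter_upwards [Iio_mem_nhds hs] with t ht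
        exact if_neg (not_lt.2 (le_of_lt ht))
      exact continuousAt_const.congr this.symm
    · have hg0 : g 0 = 0 := if_neg (lt_irrefl 0)
      rw [continuousAt_iff_continuous_left'_right']
      constructor
      · rw [ContinuousWithinAt, hg0]
        refine tendsto_const_nhds.congr' ?_
        filter_upwards [self_mem_nhdsWithin] with t ht
        exact (if_neg (not_lt.2 (le_of_lt ht))).symm
      · rw [ContinuousWithinAt, hg0]
        refine h0.congr' ?_
        filter_upwards [self_mem_nhdsWithin] with t ht
        exact (hgpos t ht).symm
    · have : g =ᶠ[𝓝 s] f := by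
        filter_upwards [Ioi_mem_nhds hs] with t ht using hgpos t ht
      exact (hf.continuousAt (Ioi_mem_nhds hs)).congr this.symm
  refine ⟨fun u => ∫ x in (0 : ℝ)..u, g x, fun s hs => ?_, ?_⟩
  · rw [← hgpos s hs]
    exact (hcont.integral_hasStrictDerivAt 0 s).hasDerivAt
  · have := (hcont.integral_hasStrictDerivAt 0 0).hasDerivAt.continuousAt.tendsto
    rw [intervalIntegral.integral_same] at this
    exact this.mono_left nhdsWithin_le_nhds

theorem tendsto_pow_nhdsGT_zero {m : ℕ} (hm : m ≠ 0) :
    Tendsto (fun s : ℝ => s ^ m) (𝓝[>] 0) (𝓝 0) := by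
  have : Tendsto (fun s : ℝ => s ^ m) (𝓝 0) (𝓝 0) := by
    simpa [hm] using (continuous_pow m).tendsto (0 : ℝ)
  exact this.mono_left nhdsWithin_le_nhds

theorem tendsto_div_pow_succ {F f : ℝ → ℝ} {c : ℝ} (m : ℕ)
    (hF : ∀ s, 0 < s → HasDerivAt F (f s) s) (hF0 : Tendsto F (𝓝[>] 0) (𝓝 0))
    (hf : Tendsto (fun s => f s / s ^ m) (𝓝[>] 0) (𝓝 c)) :
    Tendsto (fun s => F s / s ^ (m + 1)) (𝓝[>] 0) (𝓝 (c / (m + 1))) := by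
  have hm : (m + 1 : ℝ) ≠ 0 := by positivity
  refine HasDerivAt.lhopital_zero_nhdsGT (f' := f) (g' := fun s => (m + 1) * s ^ m)
    ?_ ?_ ?_ hF0 (tendsto_pow_nhdsGT_zero (Nat.succ_ne_zero m)) ?_
  · filter_upwards [self_mem_nhdsWithin] with s hs using hF s hs
  · exact Eventually.of_forall fun s => by simpa using hasDerivAt_pow (m + 1) s
  · filter_upwards [self_mem_nhdsWithin] with s hs
    exact mul_ne_zero hm (pow_ne_zero _ (ne_of_gt hs))
  · refine (hf.div_const (m + 1 : ℝ)).congr fun s => ?_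
    rw [div_div, mul_comm]

theorem contDiffOn_succ_of_hasDerivAt {f f' : ℝ → ℝ} {k : ℕ}
    (hf : ∀ s, 0 < s → HasDerivAt f (f' s) s) (h : ContDiffOn ℝ k f' (Ioi 0)) :
    ContDiffOn ℝ (k + 1) f (Ioi 0) := by
  rw [contDiffOn_succ_iff_deriv_of_isOpen isOpen_Ioi]
  refine ⟨fun s hs => (hf s hs).differentiableAt.differentiableWithinAt, by simp, ?_⟩
  exact h.congr fun s hs => (hf s hs).deriv

theorem hasDerivAt_deriv_of_contDiffOn_two {f : ℝ → ℝ} (hf : ContDiffOn ℝ 2 f (Ioi 0)) {s : ℝ}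
    (hs : 0 < s) : HasDerivAt f (deriv f s) s ∧
      HasDerivAt (deriv f) (deriv (deriv f) s) s := by
  have h2 : ContDiffOn ℝ (1 + 1) f (Ioi 0) := by
    rw [one_add_one_eq_two]; exact hf
  have h3 := (contDiffOn_succ_iff_deriv_of_isOpen isOpen_Ioi).1 h2
  exact ⟨(h3.1.differentiableAt (isOpen_Ioi.mem_nhds hs)).hasDerivAt,
    ((h3.2.2.differentiableOn (by norm_num)).differentiableAt (isOpen_Ioi.mem_nhds hs)).hasDerivAt⟩

/-! ### The profile equation and the sign of `σB'` -/

/-- The scale derivative `σ V'(σ)`. -/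
noncomputable def scaleDeriv (V : ℝ → ℝ) (σ : ℝ) : ℝ := σ * deriv V σ

/-- The derivative of `σ V'(σ)` for a solution `V` of `𝓕[V] = 0`. -/
noncomputable def scaleRate (n : ℕ) (V : ℝ → ℝ) (σ : ℝ) : ℝ :=
  (scaleDeriv V σ ^ 2 / 2 - ((n : ℝ) - 1 - 2 * V σ) * scaleDeriv V σ
    - 2 * ((n : ℝ) - 1) * V σ * (1 - V σ)) / (σ * V σ)

namespace IsBryantSoliton

variable {n : ℕ} {B : ℝ → ℝ}

theorem hasDerivAt (hB : IsBryantSoliton n B) {s : ℝ} (hs : 0 < s) :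
    HasDerivAt B (scaleDeriv B s / s) s := by
  have h := (hasDerivAt_deriv_of_contDiffOn_two hB.contDiffOn hs).1
  rwa [scaleDeriv, mul_div_cancel_left₀ _ hs.ne']

theorem hasDerivAt_scaleDeriv (hB : IsBryantSoliton n B) {s : ℝ} (hs : 0 < s) :
    HasDerivAt (scaleDeriv B) (scaleRate n B s) s := by
  have h := (hasDerivAt_deriv_of_contDiffOn_two hB.contDiffOn hs).2
  have h1 := (hasDerivAt_id s).mul h
  refine h1.congr_deriv ?_
  have hst := hB.stationary s hs
  have hp := (hB.pos s hs).ne'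
  have hs' := hs.ne'
  unfold opF at hst
  unfold scaleRate scaleDeriv
  rw [eq_div_iff (mul_ne_zero hs' hp)]
  field_simp at hst
  simp only [id]
  linear_combination (1 / 2) * hst

theorem scaleRate_neg (hB : IsBryantSoliton n B) (hn : 2 ≤ n) {s : ℝ} (hs : 0 < s)
    (h : scaleDeriv B s = 0) : scaleRate n B s < 0 := by
  have hn' : (2 : ℝ) ≤ n := by exact_mod_cast hn
  have hp := hB.pos s hs
  have h1 := hB.lt_one s hs
  unfold scaleRate
  rw [h]
  refine div_neg_of_neg_of_pos ?_ (mul_pos hs hp)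
  have : 0 < 2 * ((n : ℝ) - 1) * B s * (1 - B s) :=
    mul_pos (mul_pos (by linarith) hp) (by linarith)
  linarith

/-- Since `y' < 0` at every zero of `y`, positivity of `y` at `s` propagates back to all of `(0,
s]`. Then `B` increases there from its limit `1`, against `B < 1`. -/
theorem scaleDeriv_nonpos (hB : IsBryantSoliton n B) (hn : 2 ≤ n) {s : ℝ} (hs : 0 < s) :
    scaleDeriv B s ≤ 0 := by
  by_contra! hcon
  have hpos : ∀ t, 0 < t → t ≤ s → 0 < scaleDeriv B t := by
    intro t ht hts
    by_contra! h0
    refine absurd ?_ (not_le.2 hcon)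
    refine image_le_of_deriv_right_lt_deriv_boundary' (f := scaleDeriv B)
      (f' := scaleRate n B) (a := t) (b := s) (B := fun _ => 0) (B' := fun _ => 0)
      (fun r hr => (hB.hasDerivAt_scaleDeriv
        (ht.trans_le hr.1)).continuousAt.continuousWithinAt)
      (fun r hr => (hB.hasDerivAt_scaleDeriv (ht.trans_le hr.1)).hasDerivWithinAt) h0
      continuousOn_const (fun r _ => hasDerivWithinAt_const _ _ _) ?_ ⟨hts, le_rfl⟩
    intro r hr h
    exact hB.scaleRate_neg hn (ht.trans_le hr.1) h
  have hmono : MonotoneOn B (Ioc 0 s) := by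
    refine monotoneOn_of_hasDerivWithinAt_nonneg (f' := fun t => scaleDeriv B t / t)
      (convex_Ioc 0 s) (fun t ht => (hB.hasDerivAt ht.1).continuousAt.continuousWithinAt) ?_ ?_
    · intro t ht
      rw [interior_Ioc] at ht
      exact (hB.hasDerivAt ht.1).hasDerivWithinAt
    · intro t ht
      rw [interior_Ioc] at ht
      exact div_nonneg (hpos t ht.1 ht.2.le).le ht.1.le
  have : (1 : ℝ) ≤ B s := by
    refine le_of_tendsto hB.tendsto_zero ?_
    filter_upwards [Ioc_mem_nhdsGT hs] with t ht
    exact hmono ht ⟨hs, le_rfl⟩ ht.2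
  linarith [hB.lt_one s hs]

/-- A zero of `y ≤ 0` would be a local maximum, where `y' = 0`, contradicting `scaleRate_neg`. -/
theorem scaleDeriv_neg (hB : IsBryantSoliton n B) (hn : 2 ≤ n) {s : ℝ} (hs : 0 < s) :
    scaleDeriv B s < 0 := by
  refine lt_of_le_of_ne (hB.scaleDeriv_nonpos hn hs) fun h => ?_
  have hmax : IsLocalMax (scaleDeriv B) s := by
    filter_upwards [Ioi_mem_nhds hs] with t ht
    rw [h]
    exact hB.scaleDeriv_nonpos hn ht
  have := hmax.hasDerivAt_eq_zero (hB.hasDerivAt_scaleDeriv hs)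
  linarith [hB.scaleRate_neg hn hs h]

/-! ### Asymptotics of the profile at infinity -/

theorem tendsto_sq_mul (hB : IsBryantSoliton n B) :
    Tendsto (fun s => s ^ 2 * B s) atTop (𝓝 1) := by
  have h := hB.normalized.tendsto_div_nhds_zero.add_const 1
  rw [zero_add] at h
  refine h.congr' ?_
  filter_upwards [eventually_gt_atTop 0] with s hs
  field_simp
  ring

theorem tendsto_atTop (hB : IsBryantSoliton n B) : Tendsto B atTop (𝓝 0) := by
  have h := hB.tendsto_sq_mul.mul
    (tendsto_inv_atTop_zero.comp (tendsto_pow_atTop (α := ℝ) two_ne_zero))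
  rw [mul_zero] at h
  refine h.congr' ?_
  filter_upwards [eventually_gt_atTop 0] with s hs
  simp only [Function.comp]
  field_simp

/-- The quadratic term `y²/2` is absorbed into the coefficient `Ω`; as `y < 0`, it only increases
`Ω`. -/
theorem tendsto_scaleDeriv_atTop (hB : IsBryantSoliton n B) (hn : 2 ≤ n) :
    Tendsto (scaleDeriv B) atTop (𝓝 0) := by
  have hn' : (2 : ℝ) ≤ n := by exact_mod_cast hn
  refine tendsto_of_relaxation (f' := scaleRate n B) (θ := fun s => (B s)⁻¹)
    (b := fun s => -2 * ((n : ℝ) - 1) * B s * (1 - B s))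
    (Ω := fun s => (n : ℝ) - 1 - 2 * B s - scaleDeriv B s / 2) (ω := 1 / 2) (by norm_num)
    (fun s hs => hB.hasDerivAt_scaleDeriv hs) ?_ ?_ ?_ ?_
  · intro s hs
    have hp := (hB.pos s hs).ne'
    unfold scaleRate
    field_simp
    ring
  · intro s hs
    exact (one_le_inv₀ (hB.pos s hs)).2 (hB.lt_one s hs).le
  · filter_upwards [hB.tendsto_atTop.eventually_lt_const (by norm_num : (0 : ℝ) < 1 / 4),
      eventually_gt_atTop 0] with s h hs
    linarith [hB.scaleDeriv_neg hn hs]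
  · have h := (hB.tendsto_atTop.const_mul (-2 * ((n : ℝ) - 1))).mul
      (hB.tendsto_atTop.const_sub 1)
    simpa using h

/-- As `B` and `y` tend to `0`, the relaxation equation of `y/B` has limiting equilibrium
`-2(n-1)/(n-1)`. -/
theorem tendsto_scaleDeriv_div_atTop (hB : IsBryantSoliton n B) (hn : 2 ≤ n) :
    Tendsto (fun s => scaleDeriv B s / B s) atTop (𝓝 (-2)) := by
  have hn' : (2 : ℝ) ≤ n := by exact_mod_cast hn
  have hΩ : Tendsto (fun s => (n : ℝ) - 1 - 2 * B s + scaleDeriv B s / 2) atTop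
      (𝓝 ((n : ℝ) - 1)) := by
    have := ((hB.tendsto_atTop.const_mul 2).const_sub ((n : ℝ) - 1)).add
      ((hB.tendsto_scaleDeriv_atTop hn).div_const 2)
    simpa using this
  refine tendsto_of_relaxation (θ := fun s => (B s)⁻¹)
    (f' := fun s => (scaleRate n B s * B s - scaleDeriv B s * (scaleDeriv B s / s)) / B s ^ 2)
    (b := fun s => -2 * ((n : ℝ) - 1) * (1 - B s))
    (Ω := fun s => (n : ℝ) - 1 - 2 * B s + scaleDeriv B s / 2) (ω := 1 / 2) (by norm_num)
    (fun s hs => (hB.hasDerivAt_scaleDeriv hs).div (hB.hasDerivAt hs) (hB.pos s hs).ne')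
    ?_ ?_ ?_ ?_
  · intro s hs
    have hp := (hB.pos s hs).ne'
    unfold scaleRate
    field_simp
    ring
  · intro s hs
    exact (one_le_inv₀ (hB.pos s hs)).2 (hB.lt_one s hs).le
  · exact (hΩ.eventually_const_lt (by linarith)).mono fun s hs => hs.le
  · have h := ((hB.tendsto_atTop.const_sub 1).const_mul (-2 * ((n : ℝ) - 1))).sub
      (hΩ.mul_const (-2))
    convert h using 2
    ring

/-! ### The conserved quantity and the expansion at the origin -/

/-- The scalar curvature plus the squared gradient of the potential is constant along a
steady soliton. -/
theorem exists_conserved (hB : IsBryantSoliton n B) (hn : 2 ≤ n) :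
    ∃ c : ℝ, 0 < c ∧ ∀ s, 0 < s → -n * scaleDeriv B s + n * ((n : ℝ) - 1) * (1 - B s)
      + (scaleDeriv B s / 2 - ((n : ℝ) - 1) * (1 - B s)) ^ 2 / B s = c * s ^ 2 := by
  have hn' : (2 : ℝ) ≤ n := by exact_mod_cast hn
  set G : ℝ → ℝ := fun s => -n * scaleDeriv B s + n * ((n : ℝ) - 1) * (1 - B s)
      + (scaleDeriv B s / 2 - ((n : ℝ) - 1) * (1 - B s)) ^ 2 / B s with hG
  have hder : ∀ s, 0 < s → HasDerivAt (fun s => G s / s ^ 2) 0 s := by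
    intro s hs
    have hp := (hB.pos s hs).ne'
    have hb := hB.hasDerivAt hs
    have hy := hB.hasDerivAt_scaleDeriv hs
    have h1 := ((hy.const_mul (-n : ℝ)).add ((hb.const_sub 1).const_mul (n * ((n : ℝ) - 1)))).add
      ((((hy.div_const 2).sub ((hb.const_sub 1).const_mul ((n : ℝ) - 1))).pow 2).div hb hp)
    refine (h1.div (hasDerivAt_pow 2 s) (pow_ne_zero 2 hs.ne')).congr_deriv ?_
    unfold scaleRate
    simp only [Pi.sub_apply, Pi.add_apply, Pi.pow_apply, Pi.div_apply]
    field_simp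
    ring
  refine ⟨G 1 / 1 ^ 2, ?_, fun s hs => ?_⟩
  · have h1 := hB.scaleDeriv_neg hn one_pos
    have h2 := hB.lt_one 1 one_pos
    have h3 := hB.pos 1 one_pos
    have h4 : 0 < (n : ℝ) * (-scaleDeriv B 1) := mul_pos (by linarith) (by linarith)
    have h5 : 0 ≤ (n : ℝ) * ((n : ℝ) - 1) * (1 - B 1) :=
      mul_nonneg (mul_nonneg (by linarith) (by linarith)) (by linarith)
    have h6 : 0 ≤ (scaleDeriv B 1 / 2 - ((n : ℝ) - 1) * (1 - B 1)) ^ 2 / B 1 := by positivity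
    simp only [hG]
    rw [one_pow, div_one]
    linarith
  · have h := constant_of_hasDerivAt_zero hder hs one_pos
    rw [← h, div_mul_cancel₀ _ (pow_ne_zero 2 hs.ne')]

/-- Both parts of the conserved quantity are nonnegative, so its square term is `O(s⁴)` and `-y +
(n-1)(1-B) ~ (c/n)s²`. The left side is `s^{2-n} (s^{n-1}(1-B))'`, so L'Hôpital's rule gives `κ =
c/(n(n+1))`. -/
theorem exists_tendsto_nhdsGT_zero (hB : IsBryantSoliton n B) (hn : 2 ≤ n) :
    ∃ κ : ℝ, 0 < κ ∧ Tendsto (fun s => (1 - B s) / s ^ 2) (𝓝[>] 0) (𝓝 κ) ∧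
      Tendsto (fun s => -scaleDeriv B s / s ^ 2) (𝓝[>] 0) (𝓝 (2 * κ)) := by
  have hn' : (2 : ℝ) ≤ n := by exact_mod_cast hn
  have hn0 : (n : ℝ) ≠ 0 := by linarith
  obtain ⟨c, hc, hG⟩ := hB.exists_conserved hn
  have hlim : Tendsto (fun s => (-scaleDeriv B s + ((n : ℝ) - 1) * (1 - B s)) / s ^ 2)
      (𝓝[>] 0) (𝓝 (c / n)) := by
    have hup : Tendsto (fun s => c ^ 2 * s ^ 2 / B s) (𝓝[>] 0) (𝓝 0) := by
      have := ((tendsto_pow_nhdsGT_zero two_ne_zero).const_mul (c ^ 2)).div hB.tendsto_zero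
        one_ne_zero
      rw [mul_zero, zero_div] at this
      exact this
    have hrem : Tendsto (fun s => (scaleDeriv B s / 2 - ((n : ℝ) - 1) * (1 - B s)) ^ 2 / B s
        / s ^ 2) (𝓝[>] 0) (𝓝 0) := by
      refine squeeze_zero' ?_ ?_ hup
      · filter_upwards [self_mem_nhdsWithin] with s hs
        have := hB.pos s hs
        positivity
      · filter_upwards [self_mem_nhdsWithin] with s hs
        have hs0 : 0 < s := hs
        have hp := hB.pos s hs
        have h1 := hB.scaleDeriv_neg hn hs
        have h2 := hB.lt_one s hs
        have h3 := hG s hs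
        have h4 : 0 ≤ (scaleDeriv B s / 2 - ((n : ℝ) - 1) * (1 - B s)) ^ 2 / B s := by
          positivity
        have h5 : 0 ≤ ((n : ℝ) - 1) * (1 - B s) := mul_nonneg (by linarith) (by linarith)
        have h6 : 2 * (-scaleDeriv B s / 2 + ((n : ℝ) - 1) * (1 - B s)) ≤ c * s ^ 2 * 2 := by
          nlinarith
        have h7 : (scaleDeriv B s / 2 - ((n : ℝ) - 1) * (1 - B s)) ^ 2 ≤ (c * s ^ 2) ^ 2 := by
          refine sq_le_sq' ?_ ?_ <;> nlinarith
        rw [div_div, div_le_div_iff₀ (by positivity) hp]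
        nlinarith [mul_le_mul_of_nonneg_right h7 hp.le]
    have := (hrem.const_sub c).div_const (n : ℝ)
    rw [sub_zero] at this
    refine this.congr' ?_
    filter_upwards [self_mem_nhdsWithin] with s hs
    have hs0 : s ≠ 0 := ne_of_gt hs
    have h3 := hG s hs
    rw [← eq_sub_iff_add_eq'] at h3
    rw [h3]
    field_simp
    ring
  obtain ⟨m, rfl⟩ := Nat.exists_eq_add_of_le' hn
  have hF : ∀ s, 0 < s → HasDerivAt (fun s => s ^ (m + 1) * (1 - B s))
      (s ^ m * (-scaleDeriv B s + ((m + 2 : ℕ) - 1) * (1 - B s))) s := by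
    intro s hs
    refine ((hasDerivAt_pow (m + 1) s).mul ((hB.hasDerivAt hs).const_sub 1)).congr_deriv ?_
    push_cast
    field_simp
    ring
  have hF0 : Tendsto (fun s => s ^ (m + 1) * (1 - B s)) (𝓝[>] 0) (𝓝 0) := by
    simpa using (tendsto_pow_nhdsGT_zero (Nat.succ_ne_zero m)).mul (hB.tendsto_zero.const_sub 1)
  have hK := tendsto_div_pow_succ (m + 2) hF hF0 (c := c / (m + 2 : ℕ)) (by
    refine hlim.congr' ?_
    filter_upwards [self_mem_nhdsWithin] with s hs
    have hs0 : s ≠ 0 := ne_of_gt hs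
    field_simp
    ring)
  have hK' : Tendsto (fun s => (1 - B s) / s ^ 2) (𝓝[>] 0)
      (𝓝 (c / (m + 2 : ℕ) / ((m + 2 : ℕ) + 1))) := by
    refine hK.congr' ?_
    filter_upwards [self_mem_nhdsWithin] with s hs
    have hs0 : s ≠ 0 := ne_of_gt hs
    field_simp
    ring
  refine ⟨_, ?_, hK', ?_⟩
  · positivity
  · have := hlim.sub (hK'.const_mul (((m + 2 : ℕ) : ℝ) - 1))
    have he : c / ((m + 2 : ℕ) : ℝ) - (((m + 2 : ℕ) : ℝ) - 1) *
        (c / (m + 2 : ℕ) / ((m + 2 : ℕ) + 1)) = 2 * (c / (m + 2 : ℕ) / ((m + 2 : ℕ) + 1)) := by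
      have : ((m + 2 : ℕ) : ℝ) + 1 ≠ 0 := by positivity
      field_simp
      ring
    rw [he] at this
    refine this.congr fun s => ?_
    ring

end IsBryantSoliton
-- Regularity of `σB'` and the linearization at `B`
/-- The derivative of `scaleRate n V` for a solution `V` of `𝓕[V] = 0`. -/
noncomputable def scaleAccel (n : ℕ) (V : ℝ → ℝ) (σ : ℝ) : ℝ :=
  (-((n : ℝ) - 1 - V σ) * scaleRate n V σ + 2 * scaleDeriv V σ ^ 2 / σ
    - 2 * ((n : ℝ) - 1) * (1 - 2 * V σ) * scaleDeriv V σ / σ) / (σ * V σ)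

namespace IsBryantSoliton

variable {n : ℕ} {B : ℝ → ℝ}

theorem hasDerivAt_scaleRate (hB : IsBryantSoliton n B) {s : ℝ} (hs : 0 < s) :
    HasDerivAt (scaleRate n B) (scaleAccel n B s) s := by
  have hp := (hB.pos s hs).ne'
  have hs' := hs.ne'
  have hb := hB.hasDerivAt hs
  have hy := hB.hasDerivAt_scaleDeriv hs
  have h := ((((hy.pow 2).div_const 2).sub
    (((hb.const_mul 2).const_sub ((n : ℝ) - 1)).mul hy)).sub
    ((hb.const_mul (2 * ((n : ℝ) - 1))).mul (hb.const_sub 1))).div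
    ((hasDerivAt_id s).mul hb) (mul_ne_zero hs' hp)
  refine h.congr_deriv ?_
  unfold scaleAccel
  simp only [Pi.sub_apply, Pi.mul_apply, Pi.pow_apply, id]
  unfold scaleRate
  field_simp
  ring

theorem firstVariation_eq (hB : IsBryantSoliton n B) {W : ℝ → ℝ}
    (hW : ContDiffOn ℝ 2 W (Ioi 0)) {s : ℝ} (hs : 0 < s) :
    firstVariation n B W s = B s * deriv (deriv W) s
      + ((n : ℝ) - 1 - B s - scaleDeriv B s) / s * deriv W s
      + (scaleRate n B s / s - 2 * scaleDeriv B s / s ^ 2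
        + 2 * ((n : ℝ) - 1) / s ^ 2 * (1 - 2 * B s)) * W s := by
  rw [BryantNextTerm.firstVariation_eq n hB.contDiffOn hW hs]
  have h1 : deriv B s = scaleDeriv B s / s := (hB.hasDerivAt hs).deriv
  have h2 : deriv (deriv B) s = (scaleRate n B s - scaleDeriv B s / s) / s := by
    have he : deriv B =ᶠ[𝓝 s] fun t => scaleDeriv B t / t := by
      filter_upwards [Ioi_mem_nhds hs] with t ht using (hB.hasDerivAt ht).deriv
    rw [he.deriv_eq]
    refine (((hB.hasDerivAt_scaleDeriv hs).div (hasDerivAt_id s) hs.ne').congr_deriv ?_).deriv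
    simp only [id]
    field_simp
  rw [h1, h2]
  field_simp
  ring

theorem continuousOn (hB : IsBryantSoliton n B) : ContinuousOn B (Ioi 0) :=
  fun _ hs => (hB.hasDerivAt hs).continuousAt.continuousWithinAt

theorem continuousOn_scaleDeriv (hB : IsBryantSoliton n B) :
    ContinuousOn (scaleDeriv B) (Ioi 0) :=
  fun _ hs => (hB.hasDerivAt_scaleDeriv hs).continuousAt.continuousWithinAt

theorem continuousOn_scaleRate (hB : IsBryantSoliton n B) :
    ContinuousOn (scaleRate n B) (Ioi 0) :=
  fun _ hs => (hB.hasDerivAt_scaleRate hs).continuousAt.continuousWithinAt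

theorem contDiffOn_scaleDeriv (hB : IsBryantSoliton n B) :
    ContDiffOn ℝ 2 (scaleDeriv B) (Ioi 0) := by
  have h0 : ContinuousOn (scaleAccel n B) (Ioi 0) := by
    unfold scaleAccel
    have h1 := hB.continuousOn
    have h2 := hB.continuousOn_scaleDeriv
    have h3 := hB.continuousOn_scaleRate
    have hne : ∀ s ∈ Ioi (0 : ℝ), s ≠ 0 := fun s hs => ne_of_gt hs
    have hne' : ∀ s ∈ Ioi (0 : ℝ), s * B s ≠ 0 :=
      fun s hs => mul_ne_zero (ne_of_gt hs) (hB.pos s hs).ne'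
    fun_prop (disch := assumption)
  have h1 := contDiffOn_succ_of_hasDerivAt (k := 0) (fun s hs => hB.hasDerivAt_scaleRate hs)
    (contDiffOn_zero.2 h0)
  have h2 := contDiffOn_succ_of_hasDerivAt (k := 1) (fun s hs => hB.hasDerivAt_scaleDeriv hs)
    (by simpa using h1)
  rw [← one_add_one_eq_two]
  simpa using h2

/-! ### Reduction of order: the factor `u` and its growth -/

/-- The integrating factor of the linearized operator. -/
theorem exists_weight {m : ℕ} (hB : IsBryantSoliton (m + 2) B) :
    ∃ ρ : ℝ → ℝ, (∀ s, 0 < s → 0 < ρ s) ∧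
      (∀ s, 0 < s → HasDerivAt ρ
        (ρ s * (((m + 2 : ℕ) : ℝ) - 1 - B s - scaleDeriv B s) / (s * B s)) s) ∧
      Tendsto (fun s => ρ s / s ^ m) (𝓝[>] 0) (𝓝 1) := by
  obtain ⟨κ, -, hκ, -⟩ := hB.exists_tendsto_nhdsGT_zero (Nat.le_add_left 2 m)
  have hne' : ∀ s ∈ Ioi (0 : ℝ), s * B s ≠ 0 :=
    fun s hs => mul_ne_zero (ne_of_gt hs) (hB.pos s hs).ne'
  obtain ⟨F, hF, hF0⟩ := exists_primitive
    (f := fun s => (((m + 2 : ℕ) : ℝ) - 1) * (1 - B s) / (s * B s)) (by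
      have h1 := hB.continuousOn
      fun_prop (disch := assumption)) (by
      have h1 := tendsto_pow_nhdsGT_zero one_ne_zero
      have h2 := ((hκ.mul h1).const_mul (((m + 2 : ℕ) : ℝ) - 1)).div hB.tendsto_zero one_ne_zero
      rw [mul_zero, mul_zero, zero_div] at h2
      refine h2.congr' ?_
      filter_upwards [self_mem_nhdsWithin] with s hs
      have hs0 : s ≠ 0 := ne_of_gt hs
      have hp := (hB.pos s hs).ne'
      simp only [Pi.div_apply]
      field_simp)
  -- The required logarithmic derivative splits as `m/s + (n-1)(1-B)/(sB) - B'/B`, whose middle term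
  -- is integrable at `0`.
  refine ⟨fun s => s ^ m * Real.exp (F s) / B s, ?_, ?_, ?_⟩
  · intro s hs
    have := hB.pos s hs
    positivity
  · intro s hs
    have hp := (hB.pos s hs).ne'
    refine (((hasDerivAt_pow m s).mul (hF s hs).exp).div (hB.hasDerivAt hs) hp).congr_deriv ?_
    rcases m with _ | m
    · simp
      field_simp
      ring
    · simp only [Pi.mul_apply, Nat.add_sub_cancel]
      push_cast
      field_simp
      ring
  · have h := ((Real.continuous_exp.tendsto 0).comp hF0).div hB.tendsto_zero one_ne_zero
    rw [Real.exp_zero, div_one] at h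
    refine h.congr' ?_
    filter_upwards [self_mem_nhdsWithin] with s hs
    have hs0 : s ≠ 0 := ne_of_gt hs
    simp only [Pi.div_apply, Function.comp]
    field_simp

/-- The factor `u` in the reduction of order `C = -σ B' u`, together with its derivative. -/
theorem exists_factor (hB : IsBryantSoliton n B) (hn : 2 ≤ n) :
    ∃ u ψ : ℝ → ℝ, (∀ s, 0 < s → 1 ≤ u s) ∧ Tendsto u (𝓝[>] 0) (𝓝 1) ∧
      (∀ s, 0 < s → HasDerivAt u (ψ s) s) ∧
      (∀ s, 0 < s → HasDerivAt ψ (1 / B s - ψ s * (2 * scaleRate n B s / scaleDeriv B s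
        + ((n : ℝ) - 1 - B s - scaleDeriv B s) / (s * B s))) s) := by
  obtain ⟨κ, hκ, -, hy⟩ := hB.exists_tendsto_nhdsGT_zero hn
  obtain ⟨m, rfl⟩ := Nat.exists_eq_add_of_le' hn
  obtain ⟨ρ, hρ, hρ', hρ0⟩ := hB.exists_weight
  have hyne : ∀ s, 0 < s → scaleDeriv B s ≠ 0 := fun s hs => (hB.scaleDeriv_neg hn hs).ne
  have hρc : ContinuousOn ρ (Ioi 0) := fun s hs => (hρ' s hs).continuousAt.continuousWithinAt
  have hPlim : Tendsto (fun s => scaleDeriv B s ^ 2 * ρ s / B s / s ^ (m + 4)) (𝓝[>] 0)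
      (𝓝 ((2 * κ) ^ 2)) := by
    have h := ((hy.pow 2).mul hρ0).div hB.tendsto_zero one_ne_zero
    rw [mul_one, div_one] at h
    refine h.congr' ?_
    filter_upwards [self_mem_nhdsWithin] with s hs
    have hs0 : s ≠ 0 := ne_of_gt hs
    have hp := (hB.pos s hs).ne'
    simp only [Pi.div_apply]
    field_simp
    ring
  have hP0 : Tendsto (fun s => scaleDeriv B s ^ 2 * ρ s / B s) (𝓝[>] 0) (𝓝 0) := by
    have h := hPlim.mul (tendsto_pow_nhdsGT_zero (Nat.succ_ne_zero (m + 3)))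
    rw [mul_zero] at h
    refine h.congr' ?_
    filter_upwards [self_mem_nhdsWithin] with s hs
    have hs0 : s ≠ 0 := ne_of_gt hs
    exact div_mul_cancel₀ _ (pow_ne_zero _ hs0)
  obtain ⟨I, hI, hI0⟩ := exists_primitive (f := fun s => scaleDeriv B s ^ 2 * ρ s / B s)
    (((hB.continuousOn_scaleDeriv.pow 2).mul hρc).div hB.continuousOn
      fun s hs => (hB.pos s hs).ne') hP0
  have nonneg_of : ∀ {F f : ℝ → ℝ} {c : ℝ}, (∀ s, 0 < s → HasDerivAt F (f s) s) →
      (∀ s, 0 < s → 0 ≤ f s) → Tendsto F (𝓝[>] 0) (𝓝 c) → ∀ s, 0 < s → c ≤ F s := by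
    intro F f c hF hf h0 s hs
    refine le_of_tendsto h0 ?_
    filter_upwards [Ioc_mem_nhdsGT hs] with t ht
    exact monotoneOn_Ioi_of_hasDerivAt hF hf ht.1 hs ht.2
  have hIpos := nonneg_of hI (fun s hs => by
    have := hB.pos s hs
    have := hρ s hs
    positivity) hI0
  -- The equation for `ψ` says `(y²ρψ)' = y²ρ/B`; integrating from `0` selects the solution regular
  -- at the origin.
  have hψ' : ∀ s, 0 < s → HasDerivAt (fun s => I s / (scaleDeriv B s ^ 2 * ρ s))
      (1 / B s - I s / (scaleDeriv B s ^ 2 * ρ s) *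
        (2 * scaleRate (m + 2) B s / scaleDeriv B s
        + (((m + 2 : ℕ) : ℝ) - 1 - B s - scaleDeriv B s) / (s * B s))) s := by
    intro s hs
    have hp := (hB.pos s hs).ne'
    have h1 := hyne s hs
    have h2 := (hρ s hs).ne'
    refine ((hI s hs).div (((hB.hasDerivAt_scaleDeriv hs).pow 2).mul (hρ' s hs))
      (mul_ne_zero (pow_ne_zero 2 h1) h2)).congr_deriv ?_
    simp only [Pi.mul_apply, Pi.pow_apply]
    field_simp
    ring
  have hψ0 : Tendsto (fun s => I s / (scaleDeriv B s ^ 2 * ρ s)) (𝓝[>] 0) (𝓝 0) := by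
    have h := ((tendsto_div_pow_succ (m + 4) hI hI0 hPlim).mul
      (tendsto_pow_nhdsGT_zero one_ne_zero)).div ((hy.pow 2).mul hρ0) (by positivity)
    rw [mul_zero, zero_div] at h
    refine h.congr' ?_
    filter_upwards [self_mem_nhdsWithin] with s hs
    have hs0 : s ≠ 0 := ne_of_gt hs
    have h1 := hyne s hs
    have h2 := (hρ s hs).ne'
    simp only [Pi.div_apply]
    field_simp
    ring
  obtain ⟨U, hU, hU0⟩ := exists_primitive
    (fun s hs => (hψ' s hs).continuousAt.continuousWithinAt) hψ0
  have hU1 : Tendsto (fun s => U s + 1) (𝓝[>] 0) (𝓝 1) := by simpa using hU0.add_const 1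
  -- The constant `1` adds the homogeneous solution `-y`; without it the `σ²` coefficient of `C`
  -- would vanish.
  exact ⟨fun s => U s + 1, _, nonneg_of (fun s hs => (hU s hs).add_const 1) (fun s hs =>
    div_nonneg (hIpos s hs) (mul_nonneg (sq_nonneg _) (hρ s hs).le)) hU1, hU1,
    fun s hs => (hU s hs).add_const 1, hψ'⟩

/-- Two relaxations in cascade: `s(ψ/s)' = (1 - Ωψ/s)/B` with `Ω → n-1`, because `y/B → -2` makes
`sBy'/y → 0`; then `s(u/s²)' = ψ/s - 2u/s²`. -/
theorem tendsto_factor_atTop (hB : IsBryantSoliton n B) (hn : 2 ≤ n) {u ψ : ℝ → ℝ}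
    (hu : ∀ s, 0 < s → HasDerivAt u (ψ s) s)
    (hψ : ∀ s, 0 < s → HasDerivAt ψ (1 / B s - ψ s * (2 * scaleRate n B s / scaleDeriv B s
        + ((n : ℝ) - 1 - B s - scaleDeriv B s) / (s * B s))) s) :
    Tendsto (fun s => u s / s ^ 2) atTop (𝓝 (1 / (2 * ((n : ℝ) - 1)))) := by
  have hn' : (2 : ℝ) ≤ n := by exact_mod_cast hn
  have hn1 : (n : ℝ) - 1 ≠ 0 := by linarith
  have hyne : ∀ s, 0 < s → scaleDeriv B s ≠ 0 := fun s hs => (hB.scaleDeriv_neg hn hs).ne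
  have hx := hB.tendsto_atTop
  have hy := hB.tendsto_scaleDeriv_atTop hn
  have hr := hB.tendsto_scaleDeriv_div_atTop hn
  have hΩ : Tendsto (fun s => 2 * (scaleDeriv B s / 2 - ((n : ℝ) - 1 - 2 * B s)
      - 2 * ((n : ℝ) - 1) * (1 - B s) / (scaleDeriv B s / B s)) + ((n : ℝ) - 1)
      - scaleDeriv B s) atTop (𝓝 ((n : ℝ) - 1)) := by
    have h := (((((hy.div_const 2).sub ((hx.const_mul 2).const_sub ((n : ℝ) - 1))).sub
      (((hx.const_sub 1).const_mul (2 * ((n : ℝ) - 1))).div hr (by norm_num))).const_mul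
      2).add_const ((n : ℝ) - 1)).sub hy
    have e : 2 * ((0 : ℝ) / 2 - ((n : ℝ) - 1 - 2 * 0) - 2 * ((n : ℝ) - 1) * (1 - 0) / -2)
        + ((n : ℝ) - 1) - 0 = (n : ℝ) - 1 := by ring
    rw [e] at h
    exact h
  have hs : Tendsto (fun s => ψ s / s) atTop (𝓝 (1 / ((n : ℝ) - 1))) := by
    refine tendsto_of_relaxation (θ := fun s => (B s)⁻¹) (b := fun _ => 1) (ω := 1 / 2)
      (by norm_num) (fun s hs => (hψ s hs).div (hasDerivAt_id s) hs.ne') ?_ ?_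
      ((hΩ.eventually_const_lt (by linarith)).mono fun s hs => hs.le) ?_
    · intro s hs
      have hp := (hB.pos s hs).ne'
      have h1 := hyne s hs
      unfold scaleRate
      field_simp
      ring
    · intro s hs
      exact (one_le_inv₀ (hB.pos s hs)).2 (hB.lt_one s hs).le
    · have h := (hΩ.mul_const (1 / ((n : ℝ) - 1))).const_sub 1
      rwa [mul_one_div_cancel hn1, sub_self] at h
  refine tendsto_of_relaxation (θ := fun _ => 1) (b := fun s => ψ s / s) (Ω := fun _ => 2)
    (ω := 1) one_pos (fun s hs => (hu s hs).div (hasDerivAt_pow 2 s) (pow_ne_zero 2 hs.ne'))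
    ?_ (fun _ _ => le_rfl) (Eventually.of_forall fun _ => by norm_num) ?_
  · intro s hs
    push_cast
    field_simp
  · have h := hs.sub_const (2 * (1 / (2 * ((n : ℝ) - 1))))
    convert h using 2
    field_simp
    ring

end IsBryantSoliton
-- Dilation covariance
-- Dilation by `k` multiplies `d𝓕` by `k²` but leaves `σV'` unscaled, whence the factor `k⁻²`.
theorem IsSolution.scale {n : ℕ} {V W : ℝ → ℝ} (hV : ContDiffOn ℝ 2 V (Ioi 0))
    (hW : IsSolution n V W) {k : ℝ} (hk : 0 < k) :
    IsSolution n (fun σ => V (k * σ)) (fun σ => W (k * σ) / k ^ 2) := by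
  have hcomp : ∀ {f : ℝ → ℝ}, ContDiffOn ℝ 2 f (Ioi 0) →
      ContDiffOn ℝ 2 (fun σ => f (k * σ)) (Ioi 0) := fun hf =>
    hf.comp (contDiff_const.mul contDiff_id).contDiffOn fun s hs => mul_pos hk hs
  have hV' := hcomp hV
  have hW' : ContDiffOn ℝ 2 (fun σ => W (k * σ) / k ^ 2) (Ioi 0) :=
    (hcomp hW.contDiffOn).div_const _
  have hd : ∀ f : ℝ → ℝ, deriv (fun σ => f (k * σ)) = fun σ => k * deriv f (k * σ) :=
    fun f => funext fun s => deriv_comp_mul_left k f s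
  have hdd : ∀ f : ℝ → ℝ, deriv (fun σ => k * deriv f (k * σ))
      = fun σ => k * (k * deriv (deriv f) (k * σ)) := by
    intro f
    funext s
    rw [deriv_const_mul_field, hd]
  have hdiv : deriv (fun σ => W (k * σ) / k ^ 2) = fun σ => k * deriv W (k * σ) / k ^ 2 := by
    funext s
    rw [deriv_div_const, hd]
  have hdivdiv : deriv (fun σ => k * deriv W (k * σ) / k ^ 2)
      = fun σ => k * (k * deriv (deriv W) (k * σ)) / k ^ 2 := by
    funext s
    rw [deriv_div_const, hdd]
  refine ⟨hW', fun s hs => ?_⟩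
  have hks := mul_pos hk hs
  have h := hW.equation (k * s) hks
  rw [firstVariation_eq n hV hW.contDiffOn hks] at h
  rw [firstVariation_eq n hV' hW' hs, hd, hdd, hdiv, hdivdiv]
  have hk' := hk.ne'
  have hs' := hs.ne'
  simp only
  field_simp at h ⊢
  linear_combination h

namespace IsBryantSoliton

variable {n : ℕ} {B : ℝ → ℝ}

/-! ### Homogeneous solutions and uniqueness -/

/-- The linearized operator at a Bryant soliton, applied to a 2-jet `(w, w', w'')`. -/
noncomputable def linearized (n : ℕ) (B : ℝ → ℝ) (w₀ w₁ w₂ σ : ℝ) : ℝ :=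
  B σ * w₂ + ((n : ℝ) - 1 - B σ - scaleDeriv B σ) / σ * w₁
    + (scaleRate n B σ / σ - 2 * scaleDeriv B σ / σ ^ 2
      + 2 * ((n : ℝ) - 1) / σ ^ 2 * (1 - 2 * B σ)) * w₀

/-- Infinitesimal dilation invariance: all `B(kσ)` are stationary, and `y` is their derivative at `k
= 1`. -/
theorem linearized_scaleDeriv (hB : IsBryantSoliton n B) {s : ℝ} (hs : 0 < s) :
    linearized n B (scaleDeriv B s) (scaleRate n B s) (scaleAccel n B s) s = 0 := by
  have hp := (hB.pos s hs).ne'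
  unfold linearized scaleAccel
  field_simp
  ring

theorem isSolution_of_linearized (hB : IsBryantSoliton n B) {W W₁ W₂ : ℝ → ℝ}
    (hW : ContDiffOn ℝ 2 W (Ioi 0)) (h₁ : ∀ s, 0 < s → HasDerivAt W (W₁ s) s)
    (h₂ : ∀ s, 0 < s → HasDerivAt W₁ (W₂ s) s)
    (h : ∀ s, 0 < s → linearized n B (W s) (W₁ s) (W₂ s) s = -scaleDeriv B s) :
    IsSolution n B W := by
  refine ⟨hW, fun s hs => ?_⟩
  have he : deriv W =ᶠ[𝓝 s] W₁ := by
    filter_upwards [Ioi_mem_nhds hs] with t ht using (h₁ t ht).deriv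
  rw [hB.firstVariation_eq hW hs, he.deriv_eq, (h₁ s hs).deriv, (h₂ s hs).deriv, neg_mul]
  exact h s hs

theorem linearized_of_isSolution (hB : IsBryantSoliton n B) {W : ℝ → ℝ}
    (hW : IsSolution n B W) {s : ℝ} (hs : 0 < s) :
    linearized n B (W s) (deriv W s) (deriv (deriv W) s) s = -scaleDeriv B s := by
  have h := hW.equation s hs
  rwa [hB.firstVariation_eq hW.contDiffOn hs, neg_mul] at h

/-- Homogeneous solutions that are bounded near the origin come from the scaling symmetry. -/
theorem exists_eq_mul_scaleDeriv (hB : IsBryantSoliton n B) (hn : 2 ≤ n) {w w₁ w₂ : ℝ → ℝ}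
    (h₁ : ∀ s, 0 < s → HasDerivAt w (w₁ s) s) (h₂ : ∀ s, 0 < s → HasDerivAt w₁ (w₂ s) s)
    (h : ∀ s, 0 < s → linearized n B (w s) (w₁ s) (w₂ s) s = 0) (hb : BoundedAtZero w) :
    ∃ c : ℝ, ∀ s, 0 < s → w s = c * scaleDeriv B s := by
  obtain ⟨κ, hκ, -, hy⟩ := hB.exists_tendsto_nhdsGT_zero hn
  obtain ⟨m, rfl⟩ := Nat.exists_eq_add_of_le' hn
  obtain ⟨ρ, hρ, hρ', hρ0⟩ := hB.exists_weight
  have hyne : ∀ s, 0 < s → scaleDeriv B s ≠ 0 := fun s hs => (hB.scaleDeriv_neg hn hs).ne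
  -- Abel's identity, with weight `ρ`.
  have hwronskian : ∀ s, 0 < s → HasDerivAt
      (fun s => ρ s * (w₁ s * scaleDeriv B s - w s * scaleRate (m + 2) B s)) 0 s := by
    intro s hs
    have hp := (hB.pos s hs).ne'
    refine ((hρ' s hs).mul (((h₂ s hs).mul (hB.hasDerivAt_scaleDeriv hs)).sub
      ((h₁ s hs).mul (hB.hasDerivAt_scaleRate hs)))).congr_deriv ?_
    have e1 := h s hs
    have e2 := hB.linearized_scaleDeriv hs
    unfold linearized at e1 e2
    simp only [Pi.sub_apply, Pi.mul_apply]
    field_simp at e1 e2 ⊢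
    refine mul_left_cancel₀ hs.ne' ?_
    linear_combination (ρ s * scaleDeriv B s) * e1 - (ρ s * w s) * e2
  set q := ρ 1 * (w₁ 1 * scaleDeriv B 1 - w 1 * scaleRate (m + 2) B 1) with hq
  have hquot : ∀ s, 0 < s → HasDerivAt (fun s => w s / scaleDeriv B s)
      (q / (ρ s * scaleDeriv B s ^ 2)) s := by
    intro s hs
    have hc := constant_of_hasDerivAt_zero hwronskian hs one_pos
    rw [← hq] at hc
    have h1 := hyne s hs
    have h2 := (hρ s hs).ne'
    refine ((h₁ s hs).div (hB.hasDerivAt_scaleDeriv hs) h1).congr_deriv ?_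
    rw [← hc]
    field_simp
  have hq0 : q = 0 := by
    by_contra hne
    set L := q ^ 2 / (2 * κ) ^ 2 with hL
    have hLpos : 0 < L := by positivity
    have hlim : Tendsto (fun s => s ^ (m + 4) * (q ^ 2 / (ρ s * scaleDeriv B s ^ 2)))
        (𝓝[>] 0) (𝓝 L) := by
      have ht := (tendsto_const_nhds (x := q ^ 2)).div (hρ0.mul (hy.pow 2)) (by positivity)
      rw [one_mul] at ht
      refine ht.congr' ?_
      filter_upwards [self_mem_nhdsWithin] with s hs
      have hs0 : s ≠ 0 := ne_of_gt hs
      have h1 := hyne s hs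
      have h2 := (hρ s hs).ne'
      simp only [Pi.div_apply]
      field_simp
      ring
    obtain ⟨δ, hδ, hδ'⟩ : ∃ δ > 0, ∀ s, 0 < s → s < δ →
        L / 2 ≤ s ^ (m + 4) * (q ^ 2 / (ρ s * scaleDeriv B s ^ 2)) := by
      obtain ⟨δ, hδ, hsub⟩ := mem_nhdsGT_iff_exists_Ioo_subset.1
        (hlim.eventually_const_lt (half_lt_self hLpos))
      exact ⟨δ, hδ, fun s h1 h2 => le_of_lt (hsub ⟨h1, h2⟩)⟩
    -- Chosen so that `k s^{-(m+3)}` has derivative `-(L/2) s^{-(m+4)}`, which `(q w/y)' = q²/(ρy²)`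
    -- dominates near `0`. The factor `q` removes a case split on its sign.
    set k := L / 2 / (m + 3) with hk
    have hkpos : 0 < k := by positivity
    have hmono : MonotoneOn (fun s => q * (w s / scaleDeriv B s) + k * (s ^ (m + 3))⁻¹)
        (Ioo 0 δ) := by
      have hder : ∀ s ∈ Ioo 0 δ, HasDerivAt
          (fun s => q * (w s / scaleDeriv B s) + k * (s ^ (m + 3))⁻¹)
          (q * (q / (ρ s * scaleDeriv B s ^ 2)) - L / 2 / s ^ (m + 4)) s := by
        intro s hs
        have hs0 : s ≠ 0 := hs.1.ne'
        refine (((hquot s hs.1).const_mul q).add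
          (((hasDerivAt_pow (m + 3) s).inv (pow_ne_zero _ hs0)).const_mul k)).congr_deriv ?_
        rw [sub_eq_add_neg]
        congr 1
        rw [hk]
        push_cast
        field_simp
        ring
      refine monotoneOn_of_hasDerivWithinAt_nonneg (convex_Ioo 0 δ)
        (f' := fun s => q * (q / (ρ s * scaleDeriv B s ^ 2)) - L / 2 / s ^ (m + 4))
        (fun s hs => (hder s hs).continuousAt.continuousWithinAt) ?_ ?_
      · intro s hs
        rw [interior_Ioo] at hs
        exact (hder s hs).hasDerivWithinAt
      · intro s hs
        rw [interior_Ioo] at hs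
        have h1 := hδ' s hs.1 hs.2
        have h2 : L / 2 / s ^ (m + 4) ≤ q ^ 2 / (ρ s * scaleDeriv B s ^ 2) := by
          rw [div_le_iff₀' (pow_pos hs.1 _)]
          exact h1
        rw [← mul_div_assoc, ← sq]
        linarith
    -- Bounded `w` and `y ~ -2κs²` make this `O(s^{m+1})`.
    have hz : Tendsto (fun s => s ^ (m + 3) * (q * (w s / scaleDeriv B s))) (𝓝[>] 0) (𝓝 0) := by
      obtain ⟨K, η, hη, hK⟩ := hb
      have hbdd : IsBoundedUnder (· ≤ ·) (𝓝[>] (0 : ℝ)) ((‖·‖) ∘ w) := by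
        refine isBoundedUnder_of_eventually_le (a := K) ?_
        filter_upwards [Ioo_mem_nhdsGT hη] with s hs using hK s hs.1 hs.2
      have h1 := hbdd.smul_tendsto_zero (tendsto_pow_nhdsGT_zero (m := m + 1) m.succ_ne_zero)
      have h2 := (h1.const_mul (-q)).div hy (by positivity)
      rw [mul_zero, zero_div] at h2
      refine h2.congr' ?_
      filter_upwards [self_mem_nhdsWithin] with s hs
      have hs0 : s ≠ 0 := ne_of_gt hs
      have h3 := hyne s hs
      simp only [Pi.div_apply, smul_eq_mul]
      field_simp
      ring
    set A := q * (w (δ / 2) / scaleDeriv B (δ / 2)) + k * ((δ / 2) ^ (m + 3))⁻¹ with hA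
    have hle : ∀ᶠ s in 𝓝[>] 0, s ^ (m + 3) * (q * (w s / scaleDeriv B s)) + k
        ≤ A * s ^ (m + 3) := by
      filter_upwards [Ioo_mem_nhdsGT (half_pos hδ)] with s hs
      have h1 := hmono (mem_Ioo.2 ⟨hs.1, hs.2.trans (half_lt_self hδ)⟩)
        (mem_Ioo.2 ⟨half_pos hδ, half_lt_self hδ⟩) hs.2.le
      have h2 : 0 < s ^ (m + 3) := pow_pos hs.1 _
      have h3 := mul_le_mul_of_nonneg_right h1 h2.le
      refine le_trans (le_of_eq ?_) h3
      simp only [add_mul]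
      rw [mul_assoc k, inv_mul_cancel₀ h2.ne', mul_one, mul_comm]
    -- In the limit `s → 0` this reads `k ≤ 0`.
    have := le_of_tendsto_of_tendsto (hz.add_const k)
      ((tendsto_pow_nhdsGT_zero (Nat.succ_ne_zero (m + 2))).const_mul A) hle
    linarith
  refine ⟨w 1 / scaleDeriv B 1, fun s hs => ?_⟩
  have hc := constant_of_hasDerivAt_zero (f := fun s => w s / scaleDeriv B s)
    (fun t ht => by simpa [hq0] using hquot t ht) hs one_pos
  rw [← hc, div_mul_cancel₀ _ (hyne s hs)]

/-- Reduction of order for the linearized equation. -/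
theorem isSolution_neg_scaleDeriv_mul (hB : IsBryantSoliton n B) (hn : 2 ≤ n) {u ψ : ℝ → ℝ}
    (hu : ∀ s, 0 < s → HasDerivAt u (ψ s) s)
    (hψ : ∀ s, 0 < s → HasDerivAt ψ (1 / B s - ψ s * (2 * scaleRate n B s / scaleDeriv B s
        + ((n : ℝ) - 1 - B s - scaleDeriv B s) / (s * B s))) s) :
    IsSolution n B (fun s => -scaleDeriv B s * u s) := by
  have hyne : ∀ s ∈ Ioi (0 : ℝ), scaleDeriv B s ≠ 0 := fun s hs => (hB.scaleDeriv_neg hn hs).ne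
  have hu2 : ContDiffOn ℝ 2 u (Ioi 0) := by
    have h0 : ContinuousOn (fun s => 1 / B s - ψ s * (2 * scaleRate n B s / scaleDeriv B s
        + ((n : ℝ) - 1 - B s - scaleDeriv B s) / (s * B s))) (Ioi 0) := by
      have h1 := hB.continuousOn
      have h2 := hB.continuousOn_scaleDeriv
      have h3 := hB.continuousOn_scaleRate
      have h4 : ContinuousOn ψ (Ioi 0) :=
        fun s hs => (hψ s hs).continuousAt.continuousWithinAt
      have hp : ∀ s ∈ Ioi (0 : ℝ), B s ≠ 0 := fun s hs => (hB.pos s hs).ne'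
      have hne' : ∀ s ∈ Ioi (0 : ℝ), s * B s ≠ 0 :=
        fun s hs => mul_ne_zero (ne_of_gt hs) (hp s hs)
      fun_prop (disch := assumption)
    have h1 := contDiffOn_succ_of_hasDerivAt (k := 0) hψ (contDiffOn_zero.2 h0)
    have h2 := contDiffOn_succ_of_hasDerivAt (k := 1) hu (by simpa using h1)
    rw [← one_add_one_eq_two]
    simpa using h2
  refine hB.isSolution_of_linearized (hB.contDiffOn_scaleDeriv.neg.mul hu2)
    (fun s hs => (hB.hasDerivAt_scaleDeriv hs).neg.mul (hu s hs))
    (fun s hs => ((hB.hasDerivAt_scaleRate hs).neg.mul (hu s hs)).add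
      ((hB.hasDerivAt_scaleDeriv hs).neg.mul (hψ s hs))) fun s hs => ?_
  have h0 := hB.linearized_scaleDeriv hs
  have hp := (hB.pos s hs).ne'
  have hy := hyne s hs
  unfold linearized at h0 ⊢
  simp only [Pi.neg_apply]
  field_simp at h0 ⊢
  linear_combination -(u s) * h0

theorem isSolution_and_boundedAtZero_iff (hB : IsBryantSoliton n B) (hn : 2 ≤ n) {C : ℝ → ℝ}
    (hC : IsSolution n B C) (hC0 : Tendsto C (𝓝[>] 0) (𝓝 0)) (D : ℝ → ℝ) :
    (IsSolution n B D ∧ BoundedAtZero D) ↔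
      ∃ lam : ℝ, ∀ σ : ℝ, 0 < σ → D σ = C σ - lam * σ * deriv B σ := by
  have bounded_of : ∀ {f : ℝ → ℝ}, Tendsto f (𝓝[>] 0) (𝓝 0) → BoundedAtZero f := by
    intro f hf
    obtain ⟨δ, hδ, hsub⟩ := mem_nhdsGT_iff_exists_Ioo_subset.1
      ((tendsto_zero_iff_abs_tendsto_zero f).1 hf |>.eventually_le_const one_pos)
    exact ⟨1, δ, hδ, fun s h1 h2 => hsub ⟨h1, h2⟩⟩
  have hCd : ∀ s, 0 < s → HasDerivAt C (deriv C s) s ∧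
      HasDerivAt (deriv C) (deriv (deriv C) s) s :=
    fun s hs => hasDerivAt_deriv_of_contDiffOn_two hC.contDiffOn hs
  constructor
  · rintro ⟨hD, hDb⟩
    have hDd : ∀ s, 0 < s → HasDerivAt D (deriv D s) s ∧
        HasDerivAt (deriv D) (deriv (deriv D) s) s :=
      fun s hs => hasDerivAt_deriv_of_contDiffOn_two hD.contDiffOn hs
    obtain ⟨c, hc⟩ := hB.exists_eq_mul_scaleDeriv hn (w := fun s => D s - C s)
      (w₁ := fun s => deriv D s - deriv C s)
      (w₂ := fun s => deriv (deriv D) s - deriv (deriv C) s)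
      (fun s hs => (hDd s hs).1.sub (hCd s hs).1) (fun s hs => (hDd s hs).2.sub (hCd s hs).2)
      (fun s hs => by
        have h1 := hB.linearized_of_isSolution hC hs
        have h2 := hB.linearized_of_isSolution hD hs
        unfold linearized at h1 h2 ⊢
        linear_combination h2 - h1) (by
        obtain ⟨K, δ, hδ, hK⟩ := hDb
        obtain ⟨K', δ', hδ', hK'⟩ := bounded_of hC0
        refine ⟨K + K', min δ δ', lt_min hδ hδ', fun s hs hsδ => ?_⟩
        exact (abs_sub _ _).trans (add_le_add (hK s hs (hsδ.trans_le (min_le_left _ _)))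
          (hK' s hs (hsδ.trans_le (min_le_right _ _)))))
    refine ⟨-c, fun s hs => ?_⟩
    have h := hc s hs
    simp only [scaleDeriv] at h
    linear_combination h
  · rintro ⟨lam, hlam⟩
    have hD : ∀ s ∈ Ioi (0 : ℝ), D s = C s - lam * scaleDeriv B s := by
      intro s hs
      rw [hlam s hs, scaleDeriv, mul_assoc]
    refine ⟨?_, ?_⟩
    · refine hB.isSolution_of_linearized
        (W₁ := fun s => deriv C s - lam * scaleRate n B s)
        (W₂ := fun s => deriv (deriv C) s - lam * scaleAccel n B s)
        ((hC.contDiffOn.sub (contDiffOn_const.mul hB.contDiffOn_scaleDeriv)).congr hD)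
        (fun s hs => ?_)
        (fun s hs => (hCd s hs).2.sub ((hB.hasDerivAt_scaleRate hs).const_mul lam))
        (fun s hs => ?_)
      · refine ((hCd s hs).1.sub
          ((hB.hasDerivAt_scaleDeriv hs).const_mul lam)).congr_of_eventuallyEq ?_
        filter_upwards [Ioi_mem_nhds hs] with t ht using hD t ht
      · have h1 := hB.linearized_of_isSolution hC hs
        have h2 := hB.linearized_scaleDeriv hs
        rw [hD s hs]
        unfold linearized at h1 h2 ⊢
        linear_combination h1 - lam * h2
    · obtain ⟨κ, -, -, hy⟩ := hB.exists_tendsto_nhdsGT_zero hn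
      refine bounded_of ?_
      have h := hC0.add ((hy.mul (tendsto_pow_nhdsGT_zero two_ne_zero)).const_mul lam)
      rw [mul_zero, mul_zero, add_zero] at h
      refine h.congr' ?_
      filter_upwards [self_mem_nhdsWithin] with s hs
      have hs0 : s ≠ 0 := ne_of_gt hs
      rw [hD s hs]
      field_simp
      ring

end IsBryantSoliton
end BryantNextTerm

/-! ### Assembly -/

theorem mainTheorem7 (n : ℕ) (hn : 2 ≤ n) (B : ℝ → ℝ)
    (hB : BryantNextTerm.IsBryantSoliton n B) :
    ∃ C : ℝ → ℝ,
      BryantNextTerm.IsSolution n B C ∧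
      (∀ σ : ℝ, 0 < σ → 0 < C σ) ∧
      (∃ M : ℝ, 0 < M ∧
        (fun σ : ℝ => C σ - M * σ ^ 2) =o[𝓝[>] 0] (fun σ : ℝ => σ ^ 2)) ∧
      Tendsto C atTop (𝓝 (1 / ((n : ℝ) - 1))) ∧
      (∀ D : ℝ → ℝ,
        (BryantNextTerm.IsSolution n B D ∧ BryantNextTerm.BoundedAtZero D) ↔
          ∃ lam : ℝ, ∀ σ : ℝ, 0 < σ → D σ = C σ - lam * σ * deriv B σ) ∧
      (∀ k : ℝ, 0 < k →
        BryantNextTerm.IsSolution n (fun σ => B (k * σ)) (fun σ => C (k * σ) / k ^ 2)) := by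
  obtain ⟨κ, hκ, -, hy⟩ := hB.exists_tendsto_nhdsGT_zero hn
  obtain ⟨u, ψ, hu1, hu0, hu, hψ⟩ := hB.exists_factor hn
  have hC := hB.isSolution_neg_scaleDeriv_mul hn hu hψ
  have hlim : Tendsto (fun s => -BryantNextTerm.scaleDeriv B s * u s / s ^ 2) (𝓝[>] 0)
      (𝓝 (2 * κ)) := by
    have h := hy.mul hu0
    rw [mul_one] at h
    exact h.congr fun s => by ring
  have hC0 : Tendsto (fun s => -BryantNextTerm.scaleDeriv B s * u s) (𝓝[>] 0) (𝓝 0) := by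
    have h := hlim.mul (BryantNextTerm.tendsto_pow_nhdsGT_zero two_ne_zero)
    rw [mul_zero] at h
    refine h.congr' ?_
    filter_upwards [self_mem_nhdsWithin] with s hs
    exact div_mul_cancel₀ _ (pow_ne_zero _ (ne_of_gt hs))
  refine ⟨fun s => -BryantNextTerm.scaleDeriv B s * u s, hC, ?_, ⟨2 * κ, by positivity, ?_⟩, ?_,
    hB.isSolution_and_boundedAtZero_iff hn hC hC0, fun k hk => hC.scale hB.contDiffOn hk⟩
  · intro s hs
    exact mul_pos (neg_pos.2 (hB.scaleDeriv_neg hn hs)) (one_pos.trans_le (hu1 s hs))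
  · refine isLittleO_of_tendsto' ?_ ?_
    · filter_upwards [self_mem_nhdsWithin] with s hs h
      exact absurd h (pow_ne_zero _ (ne_of_gt hs))
    · have h := hlim.sub_const (2 * κ)
      rw [sub_self] at h
      refine h.congr' ?_
      filter_upwards [self_mem_nhdsWithin] with s hs
      have hs0 : s ≠ 0 := ne_of_gt hs
      field_simp
  · have hn' : (2 : ℝ) ≤ n := by exact_mod_cast hn
    -- `C = -(y/B) · (σ²B) · (u/σ²)`, with limits `-2`, `1` and `1/(2(n-1))` for the three
    -- quotients.
    have h := (((hB.tendsto_scaleDeriv_div_atTop hn).mul hB.tendsto_sq_mul).neg).mul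
      (hB.tendsto_factor_atTop hn hu hψ)
    have e : -(-2 * 1) * (1 / (2 * ((n : ℝ) - 1))) = 1 / ((n : ℝ) - 1) := by
      have : (n : ℝ) - 1 ≠ 0 := by linarith
      field_simp
    rw [e] at h
    refine h.congr' ?_
    filter_upwards [eventually_gt_atTop 0] with s hs
    have hp := (hB.pos s hs).ne'
    field_simp
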